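/- Let the random graph $G_1^n$ on the vertices $1,\dots,n$ be built as follows: $G_1^0$ is the empty graph, and $G_1^t$ arises from $G_1^{t-1}$ by adding the vertex $t$ and one edge between $t$ and a random vertex $i$, where, given $G_1^{t-1}$, $P(i=s)=d_{G_1^{t-1}}(s)/(2t-1)$ for $1\le s\le t-1$ and $P(i=t)=1/(2t-1)$; here $d_G(s)$ is the degree of $s$ in $G$, a loop counting twice. The second degree of a vertex $t$ of $G_1^n$ is the number of edges $ij$ of $G_1^n$ with $i\ne t$, $j\ne t$ such that $it$ is an edge of $G_1^n$ (so a loop $ii$ at a neighbour $i$ of $t$ counts as one edge). Let $X_n(k)$ be the number of vertices of $G_1^n$ with second degree $k$, and let $M_n^2(k)=E\,X_n(k)$. Theorem. For every $\varepsilon>0$ there is a function $\varphi(n)=o(n)$ such that $$P\left(|X_n(k)-M_n^2(k)|\ge \frac{\varphi(n)}{k^2}\right)\to 0\qquad (n\to\infty),$$ uniformly over the integers $k$ with $1\le k\le n^{1/6-\varepsilon}$; that is, for every $\delta>0$ there is $n_0$ such that this probability is at most $\delta$ for all $n\ge n_0$ and all integers $k$ with $1\le k\le n^{1/6-\varepsilon}$.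 -/

import Mathlib

open MeasureTheory Filter Asymptotics

namespace BollobasRiordan

/-- The graphs that can occur as `G_1^n`. The vertices are `0, …, n - 1` in order of arrival
(vertex `v` here is the vertex `v + 1` in the numbering from one). Every vertex `v` brings exactly
one edge, which joins it to a vertex `G v ≤ v`; it is a loop when `G v = v`. -/
abbrev LGraph (n : ℕ) : Type := (v : Fin n) → Fin (v.val + 1)

variable {n : ℕ}

/-- The other end of the edge that the vertex `v` brought. -/
def target (G : LGraph n) (v : Fin n) : Fin n :=
  Fin.castLE (Nat.succ_le_of_lt v.isLt) (G v)

/-- The edges of the graph; no edge is ever repeated, so they form a set. -/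
def edges (G : LGraph n) : Finset (Sym2 (Fin n)) :=
  Finset.univ.image fun v => s(v, target G v)

/-- The degree of the vertex `s`: the number of ends of edges at `s`, so a loop counts twice. -/
def degree (G : LGraph n) (s : Fin n) : ℕ :=
  ∑ v : Fin n, ((if v = s then 1 else 0) + (if target G v = s then 1 else 0))

theorem sum_degree (G : LGraph n) : ∑ s, degree G s = 2 * n := by
  unfold degree
  rw [Finset.sum_comm]
  simp [Finset.sum_add_distrib]
  ring

/-- With `n` vertices present, the probability that the new vertex, `Fin.last n`, is joined to `i`:
`degree i / (2 n + 1)` for an old vertex `i`, and `1 / (2 n + 1)` for the new vertex itself. -/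
noncomputable def attachProb (G : LGraph n) : Fin (n + 1) → ENNReal :=
  Fin.lastCases (1 / (2 * n + 1)) fun s => (degree G s : ENNReal) / (2 * n + 1)

theorem sum_attachProb (G : LGraph n) : ∑ i, attachProb G i = 1 := by
  rw [Fin.sum_univ_castSucc]
  simp only [attachProb, Fin.lastCases_castSucc, Fin.lastCases_last, div_eq_mul_inv]
  rw [← Finset.sum_mul, ← add_mul, ← Nat.cast_sum, sum_degree]
  push_cast
  refine ENNReal.mul_inv_cancel (by simp) ?_
  exact_mod_cast ENNReal.natCast_ne_top (2 * n + 1)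

/-- The law of the vertex to which the new vertex is joined. -/
noncomputable def attach (G : LGraph n) : PMF (Fin (n + 1)) :=
  PMF.ofFintype (attachProb G) (sum_attachProb G)

/-- The graph with one more vertex, whose edge goes to `i`. -/
def addVertex (G : LGraph n) (i : Fin (n + 1)) : LGraph (n + 1) :=
  Fin.snoc (α := fun v : Fin (n + 1) => Fin (v.val + 1)) G i

/-- The law of the random graph `G_1^n`, built by preferential attachment from the empty graph. -/
noncomputable def law : (n : ℕ) → PMF (LGraph n)
  | 0 => PMF.pure fun v => v.elim0
  | n + 1 => (law n).bind fun G => (attach G).map (addVertex G)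

/-- The second degree of `t`: the number of edges `ij` with `i ≠ t`, `j ≠ t` and `it` an edge. -/
def secondDegree (G : LGraph n) (t : Fin n) : ℕ :=
  ((edges G).filter fun e => ∃ i j, e = s(i, j) ∧ i ≠ t ∧ j ≠ t ∧ s(i, t) ∈ edges G).card

/-- `X_n(k)`: the number of vertices with second degree `k`. -/
def X (k : ℕ) (G : LGraph n) : ℕ :=
  (Finset.univ.filter fun t => secondDegree G t = k).card

/-- `M_n^2(k)`: the expectation of `X_n(k)`. -/
noncomputable def M2 (n k : ℕ) : ℝ := ∫ G, (X k G : ℝ) ∂(law n).toMeasure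

end BollobasRiordan

/-! A second-moment argument. Moving one edge changes X_n(k) by O(k), since a vertex with a
neighbour of second degree at most k has at most k + 1 neighbours in all (`card_neighbors_le`). The
difficulty is that moving an early edge also alters later attachment probabilities. Two graphs that
differ in c edges, ending at a in one and at b in the other, are coupled: the next vertex copies a
switched end with probability c/(2n + 1), so the expected number of switched edges grows by the
factor (2n + 2)/(2n + 1). Hence averaging over the last vertex costs only this factor in the
Lipschitz constant (`SwitchLipschitz.step`). Total variance, applied vertex by vertex, gives
variance O(k² n log n) (`expect_sq_sub_sq_expect_le`), and Chebyshev's inequality finishes. -/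

namespace BollobasRiordan

/-! ### Effect of one edge on second degrees -/

/-- The second degree of `t` with respect to an arbitrary set of edges. -/
def secondDegreeOf (E : Finset (Sym2 (Fin n))) (t : Fin n) : ℕ :=
  (E.filter fun e => ∃ i j, e = s(i, j) ∧ i ≠ t ∧ j ≠ t ∧ s(i, t) ∈ E).card

/-- The number of vertices of second degree `k` with respect to an arbitrary set of edges. -/
def countOf (k : ℕ) (E : Finset (Sym2 (Fin n))) : ℕ :=
  (Finset.univ.filter fun t => secondDegreeOf E t = k).card

theorem secondDegreeOf_mono {E F : Finset (Sym2 (Fin n))} (h : E ⊆ F) (t : Fin n) :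
    secondDegreeOf E t ≤ secondDegreeOf F t := by
  refine Finset.card_le_card fun e he => ?_
  simp only [Finset.mem_filter] at he ⊢
  obtain ⟨he, i, j, h1, h2, h3, h4⟩ := he
  exact ⟨h he, i, j, h1, h2, h3, h h4⟩

/-- The neighbours of `x` with respect to a set of edges. -/
def neighbors (E : Finset (Sym2 (Fin n))) (x : Fin n) : Finset (Fin n) :=
  Finset.univ.filter fun z => s(x, z) ∈ E

/-- Every edge from x to some z ≠ t avoids t and counts towards the second degree of its neighbour
t. -/
theorem card_neighbors_le {E : Finset (Sym2 (Fin n))} {x t : Fin n} (hxt : x ≠ t)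
    (h : t ∈ neighbors E x) : (neighbors E x).card ≤ secondDegreeOf E t + 1 := by
  rw [← Finset.card_erase_add_one h]
  refine Nat.add_le_add_right (Finset.card_le_card_of_injOn (fun z => s(x, z)) ?_ ?_) 1
  · intro z hz
    simp only [neighbors, Finset.coe_erase, Set.mem_sdiff, Finset.mem_coe, Finset.mem_filter,
      Finset.mem_univ, true_and, Set.mem_singleton_iff] at hz h ⊢
    exact ⟨hz.1, x, z, rfl, hxt, hz.2, h⟩
  · intro z _ w _ hzw
    exact Sym2.congr_right.1 hzw

theorem secondDegreeOf_insert {E : Finset (Sym2 (Fin n))} {x y t : Fin n} (hx : t ≠ x)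
    (hy : t ≠ y) (h1 : t ∉ neighbors E x) (h2 : t ∉ neighbors E y) :
    secondDegreeOf (insert s(x, y) E) t = secondDegreeOf E t := by
  refine le_antisymm (Finset.card_le_card fun e he => ?_)
    (secondDegreeOf_mono (Finset.subset_insert _ _) t)
  simp only [neighbors, Finset.mem_filter, Finset.mem_univ, true_and] at h1 h2
  simp only [Finset.mem_filter, Finset.mem_insert] at he ⊢
  obtain ⟨he, i, j, rfl, hi, hj, h⟩ := he
  have hit : s(i, t) ∈ E := by
    refine h.resolve_left fun h => ?_
    rcases Sym2.eq_iff.1 h with h | h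
    · exact hy h.2
    · exact hx h.2
  refine ⟨he.resolve_left fun h => ?_, i, j, rfl, hi, hj, hit⟩
  rcases Sym2.eq_iff.1 h with h | h
  · exact h1 (h.1 ▸ hit)
  · exact h2 (h.1 ▸ hit)

theorem abs_card_filter_sub_le {α : Type*} [DecidableEq α] (s A : Finset α) (p q : α → Prop)
    [DecidablePred p] [DecidablePred q] (h : ∀ t, t ∉ A → (p t ↔ q t)) :
    |((s.filter p).card : ℝ) - (s.filter q).card| ≤ A.card := by
  have key : ∀ (p q : α → Prop) [DecidablePred p] [DecidablePred q],
      (∀ t, t ∉ A → (p t ↔ q t)) → ((s.filter p).card : ℝ) ≤ (s.filter q).card + A.card := by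
    intro p q _ _ h
    have : s.filter p ⊆ s.filter q ∪ A := by
      intro t ht
      by_cases hA : t ∈ A
      · exact Finset.mem_union_right _ hA
      · simp only [Finset.mem_filter, Finset.mem_union] at ht ⊢
        exact Or.inl ⟨ht.1, (h t hA).1 ht.2⟩
    exact_mod_cast (Finset.card_le_card this).trans (Finset.card_union_le _ _)
  rw [abs_sub_le_iff]
  constructor
  · linarith [key p q h]
  · linarith [key q p fun t ht => (h t ht).symm]

/-- Adding one edge changes the number of vertices of second degree `k` by `O(k)`. -/
theorem abs_countOf_insert_sub_le (k : ℕ) (E : Finset (Sym2 (Fin n))) (x y : Fin n) :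
    |(countOf k (insert s(x, y) E) : ℝ) - countOf k E| ≤ 2 * k + 4 := by
  -- A vertex with more than k + 1 neighbours can be ignored: its neighbours, other than itself,
  -- have second degree above k.
  let N : Fin n → Finset (Fin n) := fun z =>
    if (neighbors E z).card ≤ k + 1 then neighbors E z else ∅
  have hN : ∀ z, (N z).card ≤ k + 1 := by
    intro z
    simp only [N]
    split_ifs with h
    · exact h
    · simp
  have hmem : ∀ z t, z ≠ t → secondDegreeOf E t ≤ k → t ∉ N z → t ∉ neighbors E z := by
    intro z t hzt hk ht hn
    have := card_neighbors_le hzt hn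
    apply ht
    simp only [N]
    rwa [if_pos (by omega)]
  have hcard : ({x, y} ∪ (N x ∪ N y)).card ≤ 2 * k + 4 := by
    refine (Finset.card_union_le _ _).trans ?_
    have h1 := Finset.card_union_le (N x) (N y)
    have h2 := Finset.card_le_two (a := x) (b := y)
    have h3 := hN x
    have h4 := hN y
    omega
  refine (abs_card_filter_sub_le _ ({x, y} ∪ (N x ∪ N y)) _ _ fun t ht => ?_).trans
    (by exact_mod_cast hcard)
  simp only [Finset.mem_union, Finset.mem_insert, Finset.mem_singleton, not_or] at ht
  obtain ⟨⟨hx, hy⟩, hNx, hNy⟩ := ht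
  -- Above k, monotonicity rules out second degree k both before and after the insertion.
  by_cases hk : secondDegreeOf E t ≤ k
  · rw [secondDegreeOf_insert hx hy (hmem x t (Ne.symm hx) hk hNx)
      (hmem y t (Ne.symm hy) hk hNy)]
  · have := secondDegreeOf_mono (Finset.subset_insert s(x, y) E) t
    constructor <;> intro h <;> omega

/-! ### Redirecting edges -/

theorem edges_eq_insert (G : LGraph n) (v : Fin n) :
    edges G = insert s(v, target G v)
      ((Finset.univ.erase v).image fun w => s(w, target G w)) := by
  rw [edges, ← Finset.insert_erase (Finset.mem_univ v), Finset.image_insert,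
    Finset.insert_erase (Finset.mem_univ v)]

/-- Both graphs arise by one insertion from the same edge set, so the bound 2k + 4 is paid twice. -/
theorem abs_X_sub_le_of_eq_off (k : ℕ) {G G' : LGraph n} (v : Fin n)
    (h : ∀ w, w ≠ v → G w = G' w) : |(X k G : ℝ) - X k G'| ≤ 4 * k + 8 := by
  have hE : ((Finset.univ.erase v).image fun w => s(w, target G w)) =
      ((Finset.univ.erase v).image fun w => s(w, target G' w)) := by
    refine Finset.image_congr fun w hw => ?_
    simp only [target, h w (by simpa using hw)]
  have h1 := abs_countOf_insert_sub_le k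
    ((Finset.univ.erase v).image fun w => s(w, target G w)) v (target G v)
  have h2 := abs_countOf_insert_sub_le k
    ((Finset.univ.erase v).image fun w => s(w, target G w)) v (target G' v)
  rw [← edges_eq_insert] at h1
  rw [hE, ← edges_eq_insert, ← hE] at h2
  change |(countOf k (edges G) : ℝ) - countOf k (edges G')| ≤ _
  rw [abs_le] at h1 h2 ⊢
  constructor <;> linarith

theorem abs_X_sub_le (k : ℕ) (C : Finset (Fin n)) (G G' : LGraph n)
    (h : ∀ w, w ∉ C → G w = G' w) : |(X k G : ℝ) - X k G'| ≤ (4 * k + 8) * C.card := by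
  induction C using Finset.induction_on generalizing G with
  | empty =>
    obtain rfl : G = G' := funext fun w => h w (by simp)
    simp
  | insert v C hv ih =>
    have h1 := abs_X_sub_le_of_eq_off k (G := G) (G' := Function.update G v (G' v)) v
      fun w hw => by simp [hw]
    have h2 := ih (Function.update G v (G' v)) fun w hw => by
      by_cases hwv : w = v
      · subst hwv
        simp
      · rw [Function.update_of_ne hwv]
        exact h w (by simp [hwv, hw])
    have h3 := abs_sub_le (X k G : ℝ) (X k (Function.update G v (G' v))) (X k G')
    rw [Finset.card_insert_of_notMem hv]
    push_cast
    linarith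

/-! ### Coupling of switched graphs -/

/-- `G` and `G'` differ only in the edges brought by the vertices of `C`, which go to `a` in `G`
and to `b` in `G'`. -/
structure Switched (C : Finset (Fin n)) (a b : Fin n) (G G' : LGraph n) : Prop where
  left : ∀ v ∈ C, target G v = a
  right : ∀ v ∈ C, target G' v = b
  off : ∀ v, v ∉ C → target G v = target G' v

/-- `f` changes by at most `K` times the number of edges that are switched from one vertex to
another. -/
def SwitchLipschitz (K : ℝ) (f : LGraph n → ℝ) : Prop :=
  ∀ C a b G G', Switched C a b G G' → |f G - f G'| ≤ K * C.card

theorem switchLipschitz_X (k : ℕ) :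
    SwitchLipschitz (4 * k + 8) fun G : LGraph n => (X k G : ℝ) := by
  intro C a b G G' h
  exact abs_X_sub_le k C G G' fun w hw => Fin.castLE_injective _ (h.off w hw)

theorem target_addVertex_castSucc (G : LGraph n) (i : Fin (n + 1)) (v : Fin n) :
    target (addVertex G i) v.castSucc = (target G v).castSucc := by
  have : addVertex G i v.castSucc = G v :=
    Fin.snoc_castSucc (α := fun v : Fin (n + 1) => Fin (v.val + 1)) i G v
  ext
  simp only [target, Fin.val_castLE, Fin.val_castSucc]
  rw [this]

theorem target_addVertex_last (G : LGraph n) (i : Fin (n + 1)) :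
    target (addVertex G i) (Fin.last n) = i := by
  have : addVertex G i (Fin.last n) = i :=
    Fin.snoc_last (α := fun v : Fin (n + 1) => Fin (v.val + 1)) i G
  ext
  simp only [target, Fin.val_castLE]
  rw [this]

theorem Switched.addVertex_same {C : Finset (Fin n)} {a b : Fin n} {G G' : LGraph n}
    (h : Switched C a b G G') (i : Fin (n + 1)) :
    Switched (C.map Fin.castSuccEmb) a.castSucc b.castSucc (addVertex G i) (addVertex G' i) := by
  refine ⟨fun v hv => ?_, fun v hv => ?_, fun v hv => ?_⟩
  · obtain ⟨w, hw, rfl⟩ := Finset.mem_map.1 hv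
    simp [target_addVertex_castSucc, h.left w hw]
  · obtain ⟨w, hw, rfl⟩ := Finset.mem_map.1 hv
    simp [target_addVertex_castSucc, h.right w hw]
  · induction v using Fin.lastCases with
    | last => simp only [target_addVertex_last]
    | cast w =>
      have hw : w ∉ C := fun hw => hv (Finset.mem_map_of_mem _ hw)
      simp only [target_addVertex_castSucc, h.off w hw]

/-- The case of the coupling in which the new vertex copies a switched end: the switched set gains
one element. -/
theorem Switched.addVertex_switched {C : Finset (Fin n)} {a b : Fin n} {G G' : LGraph n}
    (h : Switched C a b G G') :
    Switched (insert (Fin.last n) (C.map Fin.castSuccEmb)) a.castSucc b.castSucc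
      (addVertex G a.castSucc) (addVertex G' b.castSucc) := by
  refine ⟨fun v hv => ?_, fun v hv => ?_, fun v hv => ?_⟩
  · rcases Finset.mem_insert.1 hv with rfl | hv
    · exact target_addVertex_last _ _
    · obtain ⟨w, hw, rfl⟩ := Finset.mem_map.1 hv
      simp [target_addVertex_castSucc, h.left w hw]
  · rcases Finset.mem_insert.1 hv with rfl | hv
    · exact target_addVertex_last _ _
    · obtain ⟨w, hw, rfl⟩ := Finset.mem_map.1 hv
      simp [target_addVertex_castSucc, h.right w hw]
  · induction v using Fin.lastCases with
    | last => exact absurd (Finset.mem_insert_self _ _) hv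
    | cast w =>
      have hw : w ∉ C := fun hw => hv (Finset.mem_insert_of_mem (Finset.mem_map_of_mem _ hw))
      simp only [target_addVertex_castSucc, h.off w hw]

theorem switched_addVertex (G : LGraph n) (i j : Fin (n + 1)) :
    Switched {Fin.last n} i j (addVertex G i) (addVertex G j) := by
  refine ⟨fun v hv => ?_, fun v hv => ?_, fun v hv => ?_⟩
  · rw [Finset.mem_singleton.1 hv, target_addVertex_last]
  · rw [Finset.mem_singleton.1 hv, target_addVertex_last]
  · induction v using Fin.lastCases with
    | last => exact absurd (Finset.mem_singleton_self _) hv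
    | cast w => simp only [target_addVertex_castSucc]

/-- The number of ends of edges at `s`, without the targets of the vertices of `C`. -/
def degreeOff (C : Finset (Fin n)) (G : LGraph n) (s : Fin n) : ℕ :=
  ∑ v : Fin n, ((if v = s then 1 else 0) + (if v ∉ C ∧ target G v = s then 1 else 0))

theorem Switched.degreeOff_eq {C : Finset (Fin n)} {a b : Fin n} {G G' : LGraph n}
    (h : Switched C a b G G') (s : Fin n) : degreeOff C G s = degreeOff C G' s := by
  refine Finset.sum_congr rfl fun v _ => ?_
  by_cases hv : v ∈ C
  · simp [hv]
  · simp [hv, h.off v hv]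

theorem degree_eq_degreeOff_add {C : Finset (Fin n)} {a : Fin n} {G : LGraph n}
    (h : ∀ v ∈ C, target G v = a) (s : Fin n) :
    degree G s = degreeOff C G s + if s = a then C.card else 0 := by
  have : (if s = a then C.card else 0) = ∑ v : Fin n, if v ∈ C ∧ s = a then 1 else 0 := by
    split_ifs with hs <;> simp [hs]
  rw [this, degree, degreeOff, ← Finset.sum_add_distrib]
  refine Finset.sum_congr rfl fun v _ => ?_
  by_cases hv : v ∈ C
  · simp [hv, h v hv, eq_comm]
  · simp [hv]

theorem sum_degreeOff {C : Finset (Fin n)} {a : Fin n} {G : LGraph n}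
    (h : ∀ v ∈ C, target G v = a) : ∑ s, degreeOff C G s + C.card = 2 * n := by
  rw [← sum_degree G, Finset.sum_congr rfl fun s _ => degree_eq_degreeOff_add h s,
    Finset.sum_add_distrib]
  simp

/-! ### Averaging over the last vertex -/

/-- The conditional expectation of `f` given the graph before the last vertex came. -/
noncomputable def step (f : LGraph (n + 1) → ℝ) (G : LGraph n) : ℝ :=
  ∑ i, (attach G i).toReal * f (addVertex G i)

theorem sum_attach_toReal (G : LGraph n) : ∑ i, (attach G i).toReal = 1 := by
  rw [← ENNReal.toReal_sum fun i _ => (attach G).apply_ne_top i, ← tsum_fintype (L := .unconditional _),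
    (attach G).tsum_coe, ENNReal.toReal_one]

theorem step_eq (f : LGraph (n + 1) → ℝ) (G : LGraph n) :
    step f G = (∑ s, (degree G s : ℝ) * f (addVertex G s.castSucc) +
      f (addVertex G (Fin.last n))) / (2 * n + 1) := by
  have hD : ((2 * n + 1 : ENNReal)).toReal = 2 * n + 1 := by
    exact_mod_cast ENNReal.toReal_natCast (2 * n + 1)
  rw [step, Fin.sum_univ_castSucc, add_div, Finset.sum_div]
  congr 1
  · refine Finset.sum_congr rfl fun s _ => ?_
    simp only [attach, PMF.ofFintype_apply, attachProb, Fin.lastCases_castSucc, ENNReal.toReal_div,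
      hD, ENNReal.toReal_natCast]
    ring
  · simp only [attach, PMF.ofFintype_apply, attachProb, Fin.lastCases_last, ENNReal.toReal_div, hD,
      ENNReal.toReal_one]
    ring

theorem step_eq_degreeOff (f : LGraph (n + 1) → ℝ) {C : Finset (Fin n)} {a : Fin n} {G : LGraph n}
    (h : ∀ v ∈ C, target G v = a) :
    step f G = (∑ s, (degreeOff C G s : ℝ) * f (addVertex G s.castSucc) +
      C.card * f (addVertex G a.castSucc) + f (addVertex G (Fin.last n))) / (2 * n + 1) := by
  rw [step_eq]
  congr 2
  simp only [degree_eq_degreeOff_add h, Nat.cast_add, add_mul, Finset.sum_add_distrib]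
  simp

theorem SwitchLipschitz.step {K : ℝ} {f : LGraph (n + 1) → ℝ} (hf : SwitchLipschitz K f) :
    SwitchLipschitz (K * ((2 * n + 2) / (2 * n + 1))) (step f) := by
  intro C a b G G' h
  have hsum : (∑ s, (degreeOff C G s : ℝ)) = 2 * n - C.card := by
    rw [eq_sub_iff_add_eq]
    exact_mod_cast sum_degreeOff h.left
  have hsame : ∀ i, |f (addVertex G i) - f (addVertex G' i)| ≤ K * C.card := fun i => by
    simpa using hf _ _ _ _ _ (h.addVertex_same i)
  have hdiff : |f (addVertex G a.castSucc) - f (addVertex G' b.castSucc)| ≤ K * (C.card + 1) := by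
    have := hf _ _ _ _ _ h.addVertex_switched
    rw [Finset.card_insert_of_notMem (by simp [Fin.castSucc_ne_last])] at this
    simpa using this
  have hpos : (0 : ℝ) < 2 * n + 1 := by positivity
  rw [step_eq_degreeOff f h.left, step_eq_degreeOff f h.right, ← sub_div, abs_div, abs_of_pos hpos,
    div_le_iff₀ hpos]
  -- Coupling weights: 2n - |C| for common ends and 1 for the loop keep |C| switched edges; weight
  -- |C| yields |C| + 1.
  have hrhs : K * ((2 * n + 2) / (2 * n + 1)) * C.card * (2 * n + 1) =
      (∑ s, (degreeOff C G s : ℝ)) * (K * C.card) + C.card * (K * (C.card + 1)) + K * C.card := by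
    rw [hsum]
    field_simp
    ring
  rw [hrhs]
  have hlhs : (∑ s, (degreeOff C G s : ℝ) * f (addVertex G s.castSucc) +
      C.card * f (addVertex G a.castSucc) + f (addVertex G (Fin.last n))) -
      (∑ s, (degreeOff C G' s : ℝ) * f (addVertex G' s.castSucc) +
      C.card * f (addVertex G' b.castSucc) + f (addVertex G' (Fin.last n))) =
      (∑ s, (degreeOff C G s : ℝ) * (f (addVertex G s.castSucc) - f (addVertex G' s.castSucc)) +
      C.card * (f (addVertex G a.castSucc) - f (addVertex G' b.castSucc))) +
      (f (addVertex G (Fin.last n)) - f (addVertex G' (Fin.last n))) := by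
    simp only [← h.degreeOff_eq, mul_sub, Finset.sum_sub_distrib]
    ring
  rw [hlhs]
  refine (abs_add_le _ _).trans (add_le_add ((abs_add_le _ _).trans (add_le_add ?_ ?_)) (hsame _))
  · refine (Finset.abs_sum_le_sum_abs _ _).trans ?_
    rw [Finset.sum_mul]
    refine Finset.sum_le_sum fun s _ => ?_
    rw [abs_mul, Nat.abs_cast]
    exact mul_le_mul_of_nonneg_left (hsame _) (Nat.cast_nonneg _)
  · rw [abs_mul, Nat.abs_cast]
    exact mul_le_mul_of_nonneg_left hdiff (Nat.cast_nonneg _)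

/-- The variance is at most the second moment about any value c. Here c comes from the loop, and all
choices of the last target differ by one switched edge. -/
theorem step_sq_sub_sq_step_le {K : ℝ} {f : LGraph (n + 1) → ℝ} (hf : SwitchLipschitz K f)
    (G : LGraph n) : step (fun G => f G ^ 2) G - step f G ^ 2 ≤ K ^ 2 := by
  set c := f (addVertex G (Fin.last n))
  have hc : ∑ i, (attach G i).toReal * (f (addVertex G i) - c) ^ 2 ≤ K ^ 2 := by
    rw [← one_mul (K ^ 2), ← sum_attach_toReal G, Finset.sum_mul]
    refine Finset.sum_le_sum fun i _ => mul_le_mul_of_nonneg_left ?_ ENNReal.toReal_nonneg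
    have := hf _ _ _ _ _ (switched_addVertex G i (Fin.last n))
    rw [Finset.card_singleton, Nat.cast_one, mul_one] at this
    exact sq_le_sq' (abs_le.1 this).1 (abs_le.1 this).2
  have hexp : ∑ i, (attach G i).toReal * (f (addVertex G i) - c) ^ 2 =
      step (fun G => f G ^ 2) G - 2 * c * step f G + c ^ 2 := by
    have : c ^ 2 = ∑ i, (attach G i).toReal * c ^ 2 := by
      rw [← Finset.sum_mul, sum_attach_toReal, one_mul]
    rw [this, step, step, Finset.mul_sum, ← Finset.sum_sub_distrib, ← Finset.sum_add_distrib]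
    exact Finset.sum_congr rfl fun i _ => by ring
  nlinarith [sq_nonneg (step f G - c)]

/-! ### Variance and concentration -/

/-- The expectation of `f` under the law of the random graph. -/
noncomputable def expect (f : LGraph n → ℝ) : ℝ := ∑ G, (law n G).toReal * f G

theorem sum_law_toReal (n : ℕ) : ∑ G, (law n G).toReal = 1 := by
  rw [← ENNReal.toReal_sum fun i _ => (law n).apply_ne_top i, ← tsum_fintype (L := .unconditional _),
    (law n).tsum_coe, ENNReal.toReal_one]

theorem integral_law (f : LGraph n → ℝ) : ∫ G, f G ∂(law n).toMeasure = expect f := by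
  rw [PMF.integral_eq_sum]
  rfl

theorem expect_succ (f : LGraph (n + 1) → ℝ) : expect f = expect (step f) := by
  have hlaw : ∀ H, (law (n + 1) H).toReal =
      ∑ G, (law n G).toReal * ∑ i, if H = addVertex G i then (attach G i).toReal else 0 := by
    intro H
    rw [law, PMF.bind_apply, tsum_fintype, ENNReal.toReal_sum]
    · refine Finset.sum_congr rfl fun G _ => ?_
      rw [ENNReal.toReal_mul, PMF.map_apply, tsum_fintype, ENNReal.toReal_sum]
      · congr 1
        refine Finset.sum_congr rfl fun i _ => ?_
        split_ifs <;> simp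
      · intro i _
        split_ifs
        · exact (attach G).apply_ne_top i
        · simp
    · exact fun G _ => ENNReal.mul_ne_top ((law n).apply_ne_top G) (PMF.apply_ne_top _ _)
  simp only [expect, hlaw, Finset.sum_mul, step]
  rw [Finset.sum_comm]
  refine Finset.sum_congr rfl fun G _ => ?_
  simp only [mul_assoc, ← Finset.mul_sum, Finset.sum_mul]
  rw [Finset.sum_comm]
  congr 1
  refine Finset.sum_congr rfl fun i _ => ?_
  simp [ite_mul]

/-- By total variance, the last vertex contributes at most K², and the rest is the variance of `step
f`, whose constant is larger. Hence the induction is over all K. -/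
theorem expect_sq_sub_sq_expect_le {n : ℕ} {K : ℝ} {f : LGraph n → ℝ} (hf : SwitchLipschitz K f) :
    expect (fun G => f G ^ 2) - expect f ^ 2 ≤ K ^ 2 * (n * (harmonic n : ℝ)) := by
  induction n generalizing K with
  | zero =>
    have h0 : ∀ g : LGraph 0 → ℝ, expect g = g default := by
      intro g
      have := sum_law_toReal 0
      rw [Fintype.sum_unique] at this
      rw [expect, Fintype.sum_unique, this, one_mul]
      exact congrArg g (Subsingleton.elim _ _)
    simp [h0]
  | succ m ih =>
    have h1 := ih hf.step
    have h2 : expect (step fun G => f G ^ 2) - expect (fun G => step f G ^ 2) ≤ K ^ 2 := by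
      rw [expect, expect, ← Finset.sum_sub_distrib, ← one_mul (K ^ 2), ← sum_law_toReal m,
        Finset.sum_mul]
      refine Finset.sum_le_sum fun G _ => ?_
      rw [← mul_sub]
      exact mul_le_mul_of_nonneg_left (step_sq_sub_sq_step_le hf G) ENNReal.toReal_nonneg
    rw [expect_succ, expect_succ f]
    have hH : (0 : ℝ) ≤ harmonic m := by
      rw [harmonic]
      push_cast
      positivity
    -- Since 4m(m + 1) ≤ (2m + 1)², the squared growth factor is at most (m + 1)/m for m > 0; the
    -- product of these factors telescopes, leaving n times a harmonic sum.
    have h3 : ((2 * m + 2 : ℝ) / (2 * m + 1)) ^ 2 * m ≤ m + 1 := by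
      rw [div_pow, div_mul_eq_mul_div, div_le_iff₀ (by positivity)]
      have : (0 : ℝ) ≤ m := Nat.cast_nonneg m
      nlinarith
    have h4 : (K * ((2 * m + 2) / (2 * m + 1))) ^ 2 * (m * (harmonic m : ℝ)) ≤
        K ^ 2 * ((m + 1) * harmonic m) := by
      have := mul_le_mul_of_nonneg_left (mul_le_mul_of_nonneg_right h3 hH) (sq_nonneg K)
      refine le_of_eq_of_le ?_ this
      ring
    have h5 : K ^ 2 * (((m + 1 : ℕ) : ℝ) * (harmonic (m + 1) : ℝ)) =
        K ^ 2 * ((m + 1) * harmonic m) + K ^ 2 := by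
      rw [harmonic_succ]
      push_cast
      field_simp
    rw [h5]
    linarith

theorem measureReal_X_sub_M2_le (n k : ℕ) {r : ℝ} (hr : 0 < r) :
    (law n).toMeasure.real {G | r ≤ |(X k G : ℝ) - M2 n k|} ≤
      (4 * k + 8) ^ 2 * (n * (1 + Real.log n)) / r ^ 2 := by
  have hL : MemLp (fun G : LGraph n => (X k G : ℝ)) 2 (law n).toMeasure :=
    MemLp.of_discrete
  have h1 := ProbabilityTheory.meas_ge_le_variance_div_sq hL hr
  have h2 : ProbabilityTheory.variance (fun G : LGraph n => (X k G : ℝ)) (law n).toMeasure ≤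
      (4 * k + 8) ^ 2 * (n * (1 + Real.log n)) := by
    rw [ProbabilityTheory.variance_eq_sub hL]
    refine le_trans ?_ ((expect_sq_sub_sq_expect_le (switchLipschitz_X (n := n) k)).trans ?_)
    · rw [← integral_law, ← integral_law]
      exact le_rfl
    · gcongr
      exact harmonic_le_one_add_log n
  refine le_trans ?_ (div_le_div_of_nonneg_right h2 (sq_nonneg r))
  exact ENNReal.toReal_le_of_le_ofReal
    (div_nonneg (ProbabilityTheory.variance_nonneg _ _) (sq_nonneg r)) h1

end BollobasRiordan

theorem theorem3 (ε : ℝ) (hε : 0 < ε) :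
    ∃ φ : ℕ → ℝ, φ =o[atTop] (fun n : ℕ => (n : ℝ)) ∧
      ∀ δ : ℝ, 0 < δ → ∀ᶠ n : ℕ in atTop, ∀ k : ℕ, 1 ≤ k → (k : ℝ) ≤ (n : ℝ) ^ ((1 : ℝ) / 6 - ε) →
        (BollobasRiordan.law n).toMeasure.real
          {G | φ n / (k : ℝ) ^ 2 ≤ |(BollobasRiordan.X k G : ℝ) - BollobasRiordan.M2 n k|} ≤ δ := by
  -- With φ(n) = n^(1 - ε), Chebyshev gives at most 144 k⁶ (1 + log n) n^(2ε - 1), as 4k + 8 ≤ 12k;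
  -- then k⁶ ≤ n^(1 - 6ε) leaves n^(-4ε) to beat the logarithm.
  refine ⟨fun n => (n : ℝ) ^ (1 - ε), ?_, fun δ hδ => ?_⟩
  · have h : Tendsto (fun n : ℕ => (n : ℝ) ^ (-ε)) atTop (nhds 0) :=
      (tendsto_rpow_neg_atTop hε).comp tendsto_natCast_atTop_atTop
    refine (isLittleO_iff_tendsto' ?_).2 (h.congr' ?_)
    · filter_upwards [eventually_ge_atTop 1] with n hn h0
      rw [Nat.cast_eq_zero] at h0
      omega
    · filter_upwards [eventually_ge_atTop 1] with n hn
      have hn0 : (0 : ℝ) < n := by exact_mod_cast hn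
      rw [← Real.rpow_sub_one hn0.ne']
      ring_nf
  have hlim : Tendsto (fun n : ℕ => 144 * ((1 + Real.log n) * (n : ℝ) ^ (-(4 * ε)))) atTop
      (nhds 0) := by
    have h1 : Tendsto (fun x : ℝ => x ^ (-(4 * ε))) atTop (nhds 0) :=
      tendsto_rpow_neg_atTop (by positivity)
    have h2 : Tendsto (fun x : ℝ => Real.log x / x ^ (4 * ε)) atTop (nhds 0) :=
      (isLittleO_log_rpow_atTop (by positivity)).tendsto_div_nhds_zero
    have h3 := ((h1.add h2).const_mul 144).comp (tendsto_natCast_atTop_atTop (R := ℝ))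
    rw [add_zero, mul_zero] at h3
    refine h3.congr fun n => ?_
    simp only [Function.comp_apply]
    rw [Real.rpow_neg (Nat.cast_nonneg n)]
    ring
  filter_upwards [hlim.eventually_le_const hδ, eventually_ge_atTop 1] with n hn hn1 k hk hkn
  have hn0 : (0 : ℝ) < n := by exact_mod_cast hn1
  have hk1 : (1 : ℝ) ≤ k := by exact_mod_cast hk
  have hk0 : (0 : ℝ) < k := by linarith
  refine (BollobasRiordan.measureReal_X_sub_M2_le n k (by positivity)).trans (le_trans ?_ hn)
  have hlog : 0 ≤ Real.log n := Real.log_natCast_nonneg n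
  have hk6 : (k : ℝ) ^ 6 ≤ (n : ℝ) ^ (1 - 6 * ε) := by
    refine (pow_le_pow_left₀ hk0.le hkn 6).trans_eq ?_
    rw [← Real.rpow_mul_natCast hn0.le]
    congr 1
    push_cast
    ring
  rw [div_pow, div_div_eq_mul_div, div_le_iff₀ (by positivity)]
  have hpow : (n : ℝ) ^ (-(4 * ε)) * ((n : ℝ) ^ (1 - ε)) ^ 2 = (n : ℝ) ^ (1 - 6 * ε) * n := by
    nth_rw 4 [← Real.rpow_one (n : ℝ)]
    rw [← Real.rpow_mul_natCast hn0.le, ← Real.rpow_add hn0, ← Real.rpow_add hn0]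
    congr 1
    push_cast
    ring
  calc (4 * (k : ℝ) + 8) ^ 2 * (n * (1 + Real.log n)) * ((k : ℝ) ^ 2) ^ 2
      ≤ (12 * (k : ℝ)) ^ 2 * (n * (1 + Real.log n)) * ((k : ℝ) ^ 2) ^ 2 := by
        gcongr
        linarith
    _ = 144 * (n * (1 + Real.log n)) * (k : ℝ) ^ 6 := by ring
    _ ≤ 144 * (n * (1 + Real.log n)) * (n : ℝ) ^ (1 - 6 * ε) := by gcongr
    _ = 144 * ((1 + Real.log n) * (n : ℝ) ^ (-(4 * ε))) * ((n : ℝ) ^ (1 - ε)) ^ 2 := by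
        linear_combination (-144 * (1 + Real.log n)) * hpow
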